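/- For $h\in L^2(\mathbb R)$ with compact support (hence $h\in L^1(\mathbb R)$) let $\hat h(\xi)=\int_{\mathbb R}h(x)e^{-2\pi i\xi x}\,dx$. Let $\mathcal X$ be the set of all compactly supported $f\in L^2(\mathbb R)$ that are conjugate-symmetric about some point, i.e. for which there exists $t_0\in\mathbb R$ (depending on $f$) with $\overline{f(t_0-t)}=f(t_0+t)$ for almost every $t\in\mathbb R$. Theorem. Every $f\in\mathcal X$ is uniquely determined within $\mathcal X$, up to trivial ambiguities, by $|\hat f|$: if $f,g\in\mathcal X$ (with possibly different centres of symmetry) and $|\hat g(\xi)|=|\hat f(\xi)|$ for almost every $\xi\in\mathbb R$, then there exist $c\in\mathbb C$ with $|c|=1$ and $\tau\in\mathbb R$ such that either $g(x)=c\,f(x-\tau)$ for almost every $x\in\mathbb R$, or $g(x)=c\,\overline{f(\tau-x)}$ for almost every $x\in\mathbb R$. -/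

import Mathlib

open MeasureTheory
open scoped FourierTransform ComplexConjugate

namespace PhaseRetrieval

/-- `f` vanishes almost everywhere outside a compact set; this is compactness of the support for
functions that are only defined up to null sets. -/
def CompactlySupported (f : ℝ → ℂ) : Prop :=
  ∃ K : Set ℝ, IsCompact K ∧ ∀ᵐ t : ℝ, t ∉ K → f t = 0

/-- `f` is conjugate-symmetric about the point `t₀`. -/
def ConjSymmetricAbout (t₀ : ℝ) (f : ℝ → ℂ) : Prop :=
  ∀ᵐ t : ℝ, conj (f (t₀ - t)) = f (t₀ + t)

/-- The translation operator `T_τ f (x) = f (x - τ)`. -/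
def translate (τ : ℝ) (f : ℝ → ℂ) : ℝ → ℂ := fun x => f (x - τ)

/-- The reflection operator `R f (x) = f (-x)`. -/
def reflect (f : ℝ → ℂ) : ℝ → ℂ := fun x => f (-x)

/-- `g` arises from `f` by a combination of the trivial ambiguities: multiplication by a unimodular
constant, translation, and reflection together with conjugation. As elements of `L²`, either
`g = c T_τ f` or `g = c T_τ (conj (R f))`. -/
def TriviallyRelated (f g : ℝ → ℂ) : Prop :=
  ∃ (c : ℂ) (τ : ℝ), ‖c‖ = 1 ∧
    ((∀ᵐ x : ℝ, g x = c * translate τ f x) ∨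
      (∀ᵐ x : ℝ, g x = c * translate τ (fun y => conj (reflect f y)) x))

/-- The compactly supported functions in `L²(ℝ)` that are conjugate-symmetric about some point,
which may depend on the function. -/
def ConjSymmetricClass : Set (ℝ → ℂ) :=
  {f | MemLp f 2 volume ∧ CompactlySupported f ∧ ∃ t₀ : ℝ, ConjSymmetricAbout t₀ f}

end PhaseRetrieval

open Filter Topology

namespace PhaseRetrieval

/-! Moving each centre of symmetry to the origin multiplies the transform by a unimodular character,
so moduli are kept and both transforms become real. Equal moduli then give `(𝓕 g - 𝓕 f) * (𝓕 g + 𝓕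
f) = 0`. Compact support makes the transforms real analytic, and analytic functions on the connected
line have no zero divisors, so one factor vanishes identically. Fourier injectivity yields `g = ±f`
for the centred functions. -/

theorem CompactlySupported.integrable {f : ℝ → ℂ} (hc : CompactlySupported f)
    (hf : MemLp f 2 volume) : Integrable f := by
  obtain ⟨K, hK, h0⟩ := hc
  have : IsFiniteMeasure (volume.restrict K) := ⟨by simpa using hK.measure_lt_top⟩
  have h1 : IntegrableOn f K := (hf.restrict K).integrable (by norm_num)
  exact h1.integrable_of_ae_notMem_eq_zero h0

theorem CompactlySupported.exists_bound {f : ℝ → ℂ} (hc : CompactlySupported f) :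
    ∃ R : ℝ, 0 ≤ R ∧ ∀ᵐ x : ℝ, R < |x| → f x = 0 := by
  obtain ⟨K, hK, h0⟩ := hc
  obtain ⟨R, hR⟩ := hK.isBounded.exists_norm_le
  refine ⟨max R 0, le_max_right _ _, ?_⟩
  filter_upwards [h0] with x hx hlt
  refine hx fun hxK => ?_
  exact absurd (hR x hxK) (not_le.2 ((le_max_left R 0).trans_lt hlt))

theorem CompactlySupported.comp_add_right {f : ℝ → ℂ} (hc : CompactlySupported f) (s : ℝ) :
    CompactlySupported fun x => f (x + s) := by
  obtain ⟨K, hK, h0⟩ := hc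
  refine ⟨(fun x => x - s) '' K, hK.image (by fun_prop), ?_⟩
  filter_upwards [(measurePreserving_add_right volume s).quasiMeasurePreserving.ae h0] with x hx hxK
  exact hx fun h => hxK ⟨x + s, h, by simp⟩

/-- The Fourier transform of a compactly supported integrable function extends to an entire
function. -/
theorem CompactlySupported.differentiable_integral_cexp {f : ℝ → ℂ} (hc : CompactlySupported f)
    (hf : Integrable f) :
    Differentiable ℂ fun z : ℂ => ∫ x : ℝ, Complex.exp (-2 * Real.pi * x * z * Complex.I) * f x := by
  obtain ⟨R, hR0, hR⟩ := hc.exists_bound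
  intro z₀
  have hm (z : ℂ) : AEStronglyMeasurable
      (fun x : ℝ => Complex.exp (-2 * Real.pi * x * z * Complex.I)) volume :=
    Continuous.aestronglyMeasurable (by fun_prop)
  set C : ℝ := 2 * Real.pi * R
  have hC : 0 ≤ C := by positivity
  have hexp (z : ℂ) (x : ℝ) (hx : |x| ≤ R) :
      ‖Complex.exp (-2 * Real.pi * x * z * Complex.I)‖ ≤ Real.exp (C * ‖z‖) := by
    refine (Complex.norm_exp_le_exp_norm _).trans (Real.exp_le_exp.2 ?_)
    simp only [norm_mul, norm_neg, Complex.norm_I, mul_one, Complex.norm_real, Real.norm_eq_abs,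
      abs_of_pos Real.pi_pos, Complex.norm_ofNat, C]
    gcongr
  have hint (z : ℂ) :
      Integrable fun x : ℝ => Complex.exp (-2 * Real.pi * x * z * Complex.I) * f x := by
    refine (hf.norm.const_mul (Real.exp (C * ‖z‖))).mono' ((hm z).mul hf.1) ?_
    filter_upwards [hR] with x hx
    rw [norm_mul]
    rcases le_or_gt |x| R with h | h
    · gcongr
      exact hexp z x h
    · simp [hx h]
  refine (hasDerivAt_integral_of_dominated_loc_of_deriv_le (μ := volume)
    (F' := fun z (x : ℝ) => (Complex.exp (-2 * Real.pi * x * z * Complex.I) *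
      (-2 * Real.pi * x * Complex.I)) * f x)
    -- On the unit ball about `z₀`, `‖z‖ ≤ ‖z₀‖ + 1`; the extra factor `C` bounds `2π|x|` from
    -- differentiating the exponential.
    (bound := fun x => Real.exp (C * (‖z₀‖ + 1)) * C * ‖f x‖)
    (Metric.ball_mem_nhds z₀ one_pos) (Eventually.of_forall fun z => (hint z).1) (hint z₀)
    (((hm z₀).mul (Continuous.aestronglyMeasurable (by fun_prop))).mul hf.1) ?_
    (hf.norm.const_mul _) ?_).2.differentiableAt
  · filter_upwards [hR] with x hx z hz
    rw [norm_mul, norm_mul]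
    rcases le_or_gt |x| R with h | h
    · have hz' : ‖z‖ ≤ ‖z₀‖ + 1 := by
        have h1 := norm_sub_norm_le z z₀
        rw [mem_ball_iff_norm] at hz
        linarith
      gcongr
      · exact (hexp z x h).trans (by gcongr)
      · simp only [norm_mul, norm_neg, Complex.norm_I, mul_one, Complex.norm_real,
          Real.norm_eq_abs, abs_of_pos Real.pi_pos, Complex.norm_ofNat, C]
        gcongr
    · simp [hx h]
  · refine Eventually.of_forall fun x z _ => ?_
    have h1 : HasDerivAt (fun z : ℂ => -2 * Real.pi * x * z * Complex.I)
        (-2 * Real.pi * x * Complex.I) z := by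
      simpa using ((hasDerivAt_id z).const_mul (-2 * Real.pi * x : ℂ)).mul_const Complex.I
    exact h1.cexp.mul_const (f x)

/-- The Fourier transform of a compactly supported integrable function is real analytic. -/
theorem CompactlySupported.analyticOnNhd_fourier {f : ℝ → ℂ} (hc : CompactlySupported f)
    (hf : Integrable f) : AnalyticOnNhd ℝ (𝓕 f) Set.univ := by
  have h := hc.differentiable_integral_cexp hf
  intro ξ _
  have h1 := ((h.analyticAt (ξ : ℂ)).restrictScalars (𝕜 := ℝ)).comp
    (Complex.ofRealCLM.analyticAt ξ)
  convert h1 using 1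
  ext w
  simp [Real.fourier_real_eq_integral_exp_smul]

/-- The Fourier transform is injective on integrable functions. -/
theorem ae_eq_zero_of_fourier_eq_zero {f : ℝ → ℂ} (hf : Integrable f) (h : ∀ ξ, 𝓕 f ξ = 0) :
    ∀ᵐ x : ℝ, f x = 0 := by
  refine ae_eq_zero_of_integral_contDiff_smul_eq_zero hf.locallyIntegrable fun g hg hgc => ?_
  have hg₁ : HasCompactSupport (Complex.ofRealCLM ∘ g) := hgc.comp_left rfl
  have hg₂ : ContDiff ℝ ((⊤ : ℕ∞) : WithTop ℕ∞) (Complex.ofRealCLM ∘ g) := by fun_prop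
  -- Duality: the test function is the transform of a Schwartz function `ψ`, so its pairing with `f`
  -- equals that of `𝓕 f = 0` with `ψ`.
  set φ : SchwartzMap ℝ ℂ := hg₁.toSchwartzMap hg₂
  set ψ : SchwartzMap ℝ ℂ := FourierTransformInv.fourierInv φ
  have hψ : 𝓕 (ψ : ℝ → ℂ) = φ := by
    rw [← SchwartzMap.fourier_coe]
    simp [ψ]
  have key := VectorFourier.integral_fourierIntegral_smul_eq_flip (μ := volume) (ν := volume)
    (L := innerₗ ℝ) Real.continuous_fourierChar continuous_inner hf ψ.integrable
  rw [flip_innerₗ] at key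
  change ∫ ξ, 𝓕 f ξ • ψ ξ = ∫ x, f x • 𝓕 (ψ : ℝ → ℂ) x at key
  simp only [h, zero_smul, integral_zero, hψ] at key
  rw [key]
  refine integral_congr_ae (Eventually.of_forall fun x => ?_)
  simp [φ, mul_comm]

theorem fourier_add_right_eq (f : ℝ → ℂ) (s ξ : ℝ) :
    𝓕 (fun x => f (x + s)) ξ = Real.fourierChar (s * ξ) • 𝓕 f ξ := by
  rw [mul_comm s]
  exact congrFun (VectorFourier.fourierIntegral_comp_add_right Real.fourierChar volume (innerₗ ℝ) f s) ξ

/-- The Fourier transform of a function that is conjugate-symmetric about the origin is real. -/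
theorem conj_fourier_eq {f : ℝ → ℂ} (hf : ∀ᵐ x : ℝ, conj (f (-x)) = f x) (ξ : ℝ) :
    conj (𝓕 f ξ) = 𝓕 f ξ := by
  rw [Real.fourier_real_eq_integral_exp_smul, ← integral_conj,
    ← integral_neg_eq_self (μ := volume) fun v : ℝ => conj _]
  refine integral_congr_ae ?_
  filter_upwards [hf] with x hx
  rw [← hx]
  simp [← Complex.exp_conj, Complex.conj_ofNat]

/-- Two compactly supported functions that are conjugate-symmetric about the origin and whose
Fourier transforms have equal modulus agree up to sign. -/
theorem ae_eq_or_ae_eq_neg {f g : ℝ → ℂ} (hfc : CompactlySupported f) (hgc : CompactlySupported g)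
    (hfi : Integrable f) (hgi : Integrable g) (hfs : ∀ᵐ x : ℝ, conj (f (-x)) = f x)
    (hgs : ∀ᵐ x : ℝ, conj (g (-x)) = g x) (hfg : ∀ᵐ ξ : ℝ, ‖𝓕 g ξ‖ = ‖𝓕 f ξ‖) :
    (∀ᵐ x : ℝ, g x = f x) ∨ ∀ᵐ x : ℝ, g x = -f x := by
  have hfa := hfc.analyticOnNhd_fourier hfi
  have hga := hgc.analyticOnNhd_fourier hgi
  have hcf : Continuous (𝓕 f) := continuousOn_univ.1 hfa.continuousOn
  have hcg : Continuous (𝓕 g) := continuousOn_univ.1 hga.continuousOn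
  -- Continuity upgrades almost-everywhere equality to equality at every point.
  have hnorm : (fun ξ => ‖𝓕 g ξ‖) = fun ξ => ‖𝓕 f ξ‖ :=
    (hcg.norm.ae_eq_iff_eq volume hcf.norm).1 hfg
  have hsq {h : ℝ → ℂ} (hs : ∀ᵐ x : ℝ, conj (h (-x)) = h x) (ξ : ℝ) :
      𝓕 h ξ * 𝓕 h ξ = (‖𝓕 h ξ‖ : ℂ) ^ 2 := by
    rw [← Complex.mul_conj', conj_fourier_eq hs]
  have hprod : ∀ ξ ∈ Set.univ, (𝓕 g - 𝓕 f) ξ * (𝓕 g + 𝓕 f) ξ = 0 := fun ξ _ => by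
    have h1 := hsq hfs ξ
    have h2 := hsq hgs ξ
    rw [congrFun hnorm ξ] at h2
    simp only [Pi.sub_apply, Pi.add_apply]
    linear_combination h2 - h1
  have hlin (ξ : ℝ) : 𝓕 (fun x => g x - f x) ξ = 𝓕 g ξ - 𝓕 f ξ ∧
      𝓕 (fun x => g x + f x) ξ = 𝓕 g ξ + 𝓕 f ξ := by
    simp only [Real.fourier_real_eq, smul_sub, smul_add]
    have hi {h : ℝ → ℂ} (hh : Integrable h) :
        Integrable fun v : ℝ => Real.fourierChar (-(v * ξ)) • h v := by
      simpa [mul_comm] using (Real.fourierIntegral_convergent_iff ξ).2 hh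
    exact ⟨integral_sub (hi hgi) (hi hfi), integral_add (hi hgi) (hi hfi)⟩
  rcases AnalyticOnNhd.eq_zero_or_eq_zero_of_mul_eq_zero (hga.sub hfa) (hga.add hfa) hprod
    isPreconnected_univ with h | h
  · left
    filter_upwards [ae_eq_zero_of_fourier_eq_zero (hgi.sub hfi) fun ξ =>
      (hlin ξ).1.trans (h ξ (Set.mem_univ ξ))] with x hx
    exact sub_eq_zero.1 hx
  · right
    filter_upwards [ae_eq_zero_of_fourier_eq_zero (hgi.add hfi) fun ξ =>
      (hlin ξ).2.trans (h ξ (Set.mem_univ ξ))] with x hx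
    exact eq_neg_of_add_eq_zero_left hx

end PhaseRetrieval

/-- Within the class of compactly supported conjugate-symmetric functions in `L²(ℝ)`, a function
is determined up to trivial ambiguities by the modulus of its Fourier transform. Functions of the
class are integrable, so the Fourier transform `𝓕 f ξ = ∫ f x * exp (-2πi ξ x) dx` is given by
its integral. -/
theorem mainTheorem10 (f : ℝ → ℂ) (hf : f ∈ PhaseRetrieval.ConjSymmetricClass)
    (g : ℝ → ℂ) (hg : g ∈ PhaseRetrieval.ConjSymmetricClass)
    (hfg : ∀ᵐ ξ : ℝ, ‖𝓕 g ξ‖ = ‖𝓕 f ξ‖) :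
    PhaseRetrieval.TriviallyRelated f g := by
  obtain ⟨hf2, hfc, s, hfs⟩ := hf
  obtain ⟨hg2, hgc, t, hgs⟩ := hg
  have hsym {h : ℝ → ℂ} {a : ℝ} (hh : PhaseRetrieval.ConjSymmetricAbout a h) :
      ∀ᵐ x : ℝ, conj (h (-x + a)) = h (x + a) := by
    filter_upwards [hh] with x hx
    rwa [neg_add_eq_sub, add_comm x]
  have hpull {p : ℝ → Prop} (hp : ∀ᵐ x : ℝ, p x) : ∀ᵐ x : ℝ, p (x - t) :=
    (measurePreserving_sub_right volume t).quasiMeasurePreserving.ae hp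
  have key := PhaseRetrieval.ae_eq_or_ae_eq_neg (hfc.comp_add_right s) (hgc.comp_add_right t)
    ((hfc.integrable hf2).comp_add_right s) ((hgc.integrable hg2).comp_add_right t)
    (hsym hfs) (hsym hgs) (by
      filter_upwards [hfg] with ξ hξ
      simpa only [PhaseRetrieval.fourier_add_right_eq, Circle.smul_def, norm_smul,
        Circle.norm_coe, one_mul] using hξ)
  rcases key with h | h
  -- Undoing the centring: `g x = ±f (x - t + s)`. The reflected alternative is never needed, since
  -- the conjugate reflection of a conjugate-symmetric function is one of its translates.
  · refine ⟨1, t - s, by simp, Or.inl ?_⟩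
    filter_upwards [hpull h] with x hx
    rw [sub_add_cancel] at hx
    rw [hx, PhaseRetrieval.translate, one_mul]
    ring_nf
  · refine ⟨-1, t - s, by simp, Or.inl ?_⟩
    filter_upwards [hpull h] with x hx
    rw [sub_add_cancel] at hx
    rw [hx, PhaseRetrieval.translate, neg_one_mul]
    ring_nf
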